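/- In the nonuniform linear decision tree model, the $(\mathrm{median},-)$ convolution of two real vectors of length $n$ can be computed in $O(n\sqrt{n \lg n})$ time, where $\lg=\log_2$. Precisely: for real vectors $x=\langle x_0,\dots,x_{n-1}\rangle$ and $y=\langle y_0,\dots,y_{n-1}\rangle$, their $(\mathrm{median},-)$ convolution is the vector $\langle z_0,\dots,z_{n-1}\rangle$ with $$z_k=\operatorname*{median}_{0\le i\le k}\,(x_i-y_{k-i}).$$ If $k+1$ is odd, the median is the middle entry of the sorted sequence of these $k+1$ numbers (with multiplicity); if $k+1$ is even, it is $(1-\theta)a+\theta b$, where $a\le b$ are the two middle entries and $\theta\in[0,1]$ is a fixed convention ($\theta=0$: lower median; $\theta=1$: upper median; $\theta=\tfrac12$: midpoint). A linear decision tree for inputs in $\mathbb{R}^{2n}$ and outputs in $\mathbb{R}^n$ is a finite binary tree in which each internal node tests whether some affine function of the input is $\le 0$ and branches accordingly, and each leaf is labelled with $n$ affine functions of the input, whose values are the output. Its running time is its depth, the maximum number of tests on a root-to-leaf path. Nonuniform means that a different tree may be used for each $n$. Then there is a constant $C$ such that for every $n\ge 1$ and every $\theta\in[0,1]$ there is a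 linear decision tree of depth at most $C\,n\sqrt{n\log_2 n}$ whose output, on every input $(x,y)\in\mathbb{R}^n\times\mathbb{R}^n$, is the $(\mathrm{median},-)$ convolution of $x$ and $y$. -/

import Mathlib

/-- A linear decision tree on inputs in `ℝ^ι` with outputs in `ℝ^κ`.  An internal node tests
whether an affine form of the input is `≤ 0`; a leaf carries, for every output coordinate,
an affine form of the input. -/
inductive LinearDecisionTree (ι κ : Type) : Type where
  | leaf (out : κ → ((ι → ℝ) →ᵃ[ℝ] ℝ)) : LinearDecisionTree ι κ
  | node (test : (ι → ℝ) →ᵃ[ℝ] ℝ) (yes no : LinearDecisionTree ι κ) : LinearDecisionTree ι κ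

namespace LinearDecisionTree

variable {ι κ : Type}

/-- The cost of a tree: the worst-case number of tests on a root-to-leaf path. -/
def depth : LinearDecisionTree ι κ → ℕ
  | leaf _ => 0
  | node _ yes no => max yes.depth no.depth + 1

open Classical in
/-- The output of the tree on the input `v`. -/
noncomputable def run : LinearDecisionTree ι κ → (ι → ℝ) → κ → ℝ
  | leaf out, v => fun k => out k v
  | node test yes no, v => if test v ≤ 0 then yes.run v else no.run v

/-- The tree computes the function `F`: its output is correct on every real input. -/
def Computes (t : LinearDecisionTree ι κ) (F : (ι → ℝ) → κ → ℝ) : Prop :=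
  ∀ v, t.run v = F v

end LinearDecisionTree

/-- The entry at position `j` (counted from `0`) of `f` sorted into nondecreasing order,
with multiplicity. -/
noncomputable def orderStat {m : ℕ} (f : Fin m → ℝ) (j : Fin m) : ℝ :=
  f (Tuple.sort f j)

/-- The median of the `k + 1` numbers `f 0, …, f k`.  If `k + 1` is odd, this is the middle
entry of the sorted sequence, for every `θ`.  If `k + 1` is even, it is
`(1 - θ) * (lower middle entry) + θ * (upper middle entry)`: the lower median for `θ = 0`,
the upper median for `θ = 1`, the midpoint for `θ = 1 / 2`. -/
noncomputable def median (θ : ℝ) {k : ℕ} (f : Fin (k + 1) → ℝ) : ℝ :=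
  (1 - θ) * orderStat f ⟨k / 2, by omega⟩ + θ * orderStat f ⟨(k + 1) / 2, by omega⟩

/-- The `(median, -)` convolution: entry `k` is the median of `x i - y (k - i)` over
`0 ≤ i ≤ k`. -/
noncomputable def medianConv (θ : ℝ) {n : ℕ} (x y : Fin n → ℝ) (k : Fin n) : ℝ :=
  median θ (fun i : Fin ((k : ℕ) + 1) => x ⟨i, by omega⟩ - y ⟨(k : ℕ) - i, by omega⟩)

/-! The proof combines Fredman's rearrangement with Fredman's information-theoretic search.
Comparing `x i - y (k - i)` with `x j - y (k - j)` is comparing `x i - x j` with `y (k - i) - y (k -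
j)`. So sorting the `O(n d)` differences of entries of the same vector at index distance less than
`d` reveals, for every `k`, the order inside each of about `r = n / d + 1` blocks of consecutive
`i`.

All tests compare differences of coordinates, and `2n`-dimensional space has only `n ^ O(n)` sign
patterns for them (`exists_signPattern_representatives`, by Sauer–Shelah). A strategy may therefore
track a finite set of representatives carrying `bits = O(n log n)`. A weighted search in a chain
costs two tests plus two per bit of information gained (`of_threshold`, `of_chain`). These gains
telescope over the whole computation, so sorting costs `O(n d + n log n)` (`of_sort`).

For a median, `of_select` locates a pivot in all `r` blocks. The pivot is balanced for at least half
of the consistent inputs. Either it is balanced for the actual input and a quarter of the candidate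
positions disappears, or a whole bit is gained; both pay for the `2 r` overhead. Over all `k` this
is `O(n r log n)`. The choice of `d` near `√(n log n)` equalizes this with `n d`. -/

/-! ### Resolving a goal by adaptive queries -/

section Resolvable

variable {V T E : Type*}

open Classical in
/-- `Resolvable test G b S`: an adaptive strategy that knows that the input lies in `S` reaches,
after at most `b` tests, a set of consistent inputs which is empty or satisfies `G`. -/
inductive Resolvable (test : T → V → Prop) (G : Finset V → Prop) : ℝ → Finset V → Prop
  | empty (b : ℝ) : Resolvable test G b ∅
  | done {b : ℝ} {S : Finset V} : 0 ≤ b → G S → Resolvable test G b S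
  | query {b : ℝ} {S : Finset V} (τ : T) : Resolvable test G (b - 1) (S.filter (test τ)) →
      Resolvable test G (b - 1) (S.filter fun v => ¬ test τ v) → Resolvable test G b S

/-- The number of bits of information needed to single out an element of `S`. -/
noncomputable def bits (S : Finset V) : ℝ := Real.logb 2 S.card

theorem bits_mono {S S' : Finset V} (h : S' ⊆ S) (h' : S'.Nonempty) : bits S' ≤ bits S := by
  have h0 : (0 : ℝ) < S'.card := by exact_mod_cast h'.card_pos
  exact Real.logb_le_logb_of_le (by norm_num) h0 (by exact_mod_cast Finset.card_le_card h)

theorem bits_add_one_le {S S' : Finset V} (h : 2 * S'.card ≤ S.card) (h' : S'.Nonempty) :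
    bits S' + 1 ≤ bits S := by
  have h0 : (0 : ℝ) < S'.card := by exact_mod_cast h'.card_pos
  have h1 : (2 : ℝ) * S'.card ≤ S.card := by exact_mod_cast h
  have h2 := Real.logb_le_logb_of_le (b := 2) (by norm_num) (by positivity) h1
  rw [Real.logb_mul (by norm_num) h0.ne', Real.logb_self_eq_one (by norm_num)] at h2
  unfold bits
  linarith

/-- Over `S`, membership in the set `A` is decided by at most one test. -/
def Queryable (test : T → V → Prop) (S : Finset V) (A : V → Prop) : Prop :=
  (∃ τ, ∀ v ∈ S, test τ v ↔ A v) ∨ (∃ τ, ∀ v ∈ S, test τ v ↔ ¬ A v) ∨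
    (∀ v ∈ S, A v) ∨ ∀ v ∈ S, ¬ A v

variable {test : T → V → Prop} {G : Finset V → Prop}

theorem Queryable.mono {S S' : Finset V} {A : V → Prop} (h : Queryable test S A) (hS : S' ⊆ S) :
    Queryable test S' A := by
  rcases h with ⟨τ, h⟩ | ⟨τ, h⟩ | h | h
  · exact .inl ⟨τ, fun v hv => h v (hS hv)⟩
  · exact .inr (.inl ⟨τ, fun v hv => h v (hS hv)⟩)
  · exact .inr (.inr (.inl fun v hv => h v (hS hv)))
  · exact .inr (.inr (.inr fun v hv => h v (hS hv)))

theorem Queryable.not {S : Finset V} {A : V → Prop} (h : Queryable test S A) :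
    Queryable test S fun v => ¬ A v := by
  rcases h with ⟨τ, h⟩ | ⟨τ, h⟩ | h | h
  · exact .inr (.inl ⟨τ, fun v hv => by rw [not_not]; exact h v hv⟩)
  · exact .inl ⟨τ, h⟩
  · exact .inr (.inr (.inr fun v hv => not_not.2 (h v hv)))
  · exact .inr (.inr (.inl h))

theorem Queryable.congr {S : Finset V} {A B : V → Prop} (h : Queryable test S A)
    (hAB : ∀ v ∈ S, A v ↔ B v) : Queryable test S B := by
  rcases h with ⟨τ, h⟩ | ⟨τ, h⟩ | h | h
  · exact .inl ⟨τ, fun v hv => (h v hv).trans (hAB v hv)⟩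
  · exact .inr (.inl ⟨τ, fun v hv => (h v hv).trans (not_congr (hAB v hv))⟩)
  · exact .inr (.inr (.inl fun v hv => (hAB v hv).1 (h v hv)))
  · exact .inr (.inr (.inr fun v hv => (not_congr (hAB v hv)).1 (h v hv)))

namespace Resolvable

theorem mono {b b' : ℝ} {S : Finset V} (h : Resolvable test G b S) (hb : b ≤ b') :
    Resolvable test G b' S := by
  induction h generalizing b' with
  | empty => exact .empty _
  | done h0 hG => exact .done (h0.trans hb) hG
  | query τ _ _ h1 h2 => exact .query τ (h1 (by linarith)) (h2 (by linarith))

theorem of_queryable {b : ℝ} {S : Finset V} {A : V → Prop} [DecidablePred A] (hA : Queryable test S A)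
    (h1 : Resolvable test G (b - 1) (S.filter A))
    (h2 : Resolvable test G (b - 1) (S.filter fun v => ¬ A v)) : Resolvable test G b S := by
  classical
  rcases hA with ⟨τ, h⟩ | ⟨τ, h⟩ | h | h
  · refine .query τ ?_ ?_
    · rwa [Finset.filter_congr h]
    · rwa [Finset.filter_congr fun v hv => not_congr (h v hv)]
  · refine .query τ ?_ ?_
    · rwa [Finset.filter_congr h]
    · rwa [Finset.filter_congr fun v hv => not_congr (h v hv),
        Finset.filter_congr fun v _ => not_not]
  · rw [Finset.filter_true_of_mem h] at h1
    exact h1.mono (by linarith)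
  · rw [Finset.filter_true_of_mem h] at h2
    exact h2.mono (by linarith)

/-- Weighted binary search for the value of `g`. -/
theorem of_threshold {S : Finset V} {b : ℝ} (g : V → ℕ)
    (hg : ∀ j, Queryable test S fun v => g v < j)
    (H : ∀ j, (S.filter fun v => g v = j).Nonempty →
      Resolvable test G (b - 2 - 2 * (bits S - bits (S.filter fun v => g v = j)))
        (S.filter fun v => g v = j)) :
    Resolvable test G b S := by
  induction hn : S.card using Nat.strong_induction_on generalizing S b with
  | _ N ih =>
  subst hn
  rcases S.eq_empty_or_nonempty with rfl | hS
  · exact .empty _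
  have hex : ∃ j, S.card ≤ 2 * (S.filter fun v => g v < j + 1).card := by
    refine ⟨S.sup g, ?_⟩
    rw [Finset.filter_true_of_mem fun v hv => Nat.lt_succ_of_le (Finset.le_sup hv)]
    omega
  -- `j` is a weighted median of `g`: each strict side holds at most half of `S`, so the at most two
  -- tests that lead there are paid for by one bit.
  obtain ⟨j, hj, hmin⟩ : ∃ j, S.card ≤ 2 * (S.filter fun v => g v < j + 1).card ∧
      2 * (S.filter fun v => g v < j).card ≤ S.card := by
    refine ⟨Nat.find hex, Nat.find_spec hex, ?_⟩
    rcases h : Nat.find hex with _ | i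
    · simp
    · have := Nat.find_min hex (m := i) (by omega)
      omega
  have hsplit := Finset.card_filter_add_card_filter_not (s := S) (fun v => g v < j + 1)
  have hpos := hS.card_pos
  have key : ∀ (A : V → Prop) [DecidablePred A] (c : ℝ), c ≤ 2 →
      2 * (S.filter A).card ≤ S.card →
      (∀ i v w, g v = i → g w = i → (A v ↔ A w)) →
      Resolvable test G (b - c) (S.filter A) := by
    intro A _ c hc hcard hAg
    refine ih _ (by omega) (fun i => (hg i).mono (Finset.filter_subset _ _)) ?_ rfl
    intro i hi
    have heq : (S.filter A).filter (fun v => g v = i) = S.filter fun v => g v = i := by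
      obtain ⟨w, hw⟩ := hi
      simp only [Finset.mem_filter] at hw
      ext v
      simp only [Finset.mem_filter]
      constructor
      · rintro ⟨⟨h1, _⟩, h3⟩; exact ⟨h1, h3⟩
      · rintro ⟨h1, h3⟩; exact ⟨⟨h1, (hAg i v w h3 hw.2).2 hw.1.2⟩, h3⟩
    have hne : (S.filter A).Nonempty := hi.mono (Finset.filter_subset _ _)
    have := bits_add_one_le hcard hne
    rw [heq] at hi ⊢
    exact (H i hi).mono (by linarith)
  refine of_queryable (hg (j + 1)) ?_ ?_
  · refine of_queryable ((hg j).mono (Finset.filter_subset _ _)) ?_ ?_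
    · rw [Finset.filter_filter, Finset.filter_congr (q := fun v => g v < j) (by intros; omega)]
      have := key (fun v => g v < j) 2 le_rfl hmin (by intros; omega)
      rwa [show b - 1 - 1 = b - 2 by ring]
    · rw [Finset.filter_filter, Finset.filter_congr (q := fun v => g v = j) (by intros; omega)]
      rcases (S.filter fun v => g v = j).eq_empty_or_nonempty with h0 | hne
      · rw [h0]; exact .empty _
      · have := bits_mono (Finset.filter_subset (fun v => g v = j) S) hne
        exact (H j hne).mono (by linarith)
  · exact key (fun v => ¬ g v < j + 1) 1 (by norm_num) (by omega) (by intros; omega)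

/-- Searching for a member of a chain of finite sets. -/
theorem of_chain {S : Finset V} {b : ℝ} (L : V → Finset E)
    (hL : ∀ v ∈ S, ∀ w ∈ S, L v ⊆ L w ∨ L w ⊆ L v)
    (hq : ∀ e, Queryable test S fun v => e ∈ L v)
    (H : ∀ S' ⊆ S, S'.Nonempty → (∀ v ∈ S', ∀ w ∈ S', L v = L w) →
      Resolvable test G (b - 2 - 2 * (bits S - bits S')) S') :
    Resolvable test G b S := by
  have hsub : ∀ v ∈ S, ∀ w ∈ S, (L v).card ≤ (L w).card → L v ⊆ L w := by
    intro v hv w hw h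
    rcases hL v hv w hw with h1 | h1
    · exact h1
    · exact (Finset.eq_of_subset_of_card_le h1 h).ge
  refine of_threshold (fun v => (L v).card) (fun j => ?_) fun j hj => ?_
  · rcases (S.filter fun v => (L v).card < j).eq_empty_or_nonempty with h0 | h1
    · exact .inr (.inr (.inr fun v hv h => by
        have : v ∈ S.filter fun v => (L v).card < j := Finset.mem_filter.2 ⟨hv, h⟩
        simp [h0] at this))
    rcases (S.filter fun v => ¬ (L v).card < j).eq_empty_or_nonempty with h0 | h2
    · exact .inr (.inr (.inl fun v hv => by
        by_contra h
        have : v ∈ S.filter fun v => ¬ (L v).card < j := Finset.mem_filter.2 ⟨hv, h⟩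
        rw [h0] at this
        simp at this))
    -- An element of the smallest large set outside the largest small set separates the two groups,
    -- so one membership test decides the cardinality threshold.
    obtain ⟨a, ha, hamax⟩ := Finset.exists_max_image _ (fun v => (L v).card) h1
    obtain ⟨c, hc, hcmin⟩ := Finset.exists_min_image _ (fun v => (L v).card) h2
    rw [Finset.mem_filter] at ha hc
    have hnot : ¬ L c ⊆ L a := fun h => by
      have := Finset.card_le_card h
      omega
    obtain ⟨e, hec, hea⟩ := Finset.not_subset.1 hnot
    refine (hq e).not.congr fun v hv => ⟨fun h => ?_, fun h he => ?_⟩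
    · by_contra hlt
      exact h (hsub c hc.1 v hv (hcmin v (Finset.mem_filter.2 ⟨hv, hlt⟩)) hec)
    · exact hea (hsub v hv a ha.1 (hamax v (Finset.mem_filter.2 ⟨hv, h⟩)) he)
  · refine H _ (Finset.filter_subset _ _) hj fun v hv w hw => ?_
    rw [Finset.mem_filter] at hv hw
    exact Finset.eq_of_subset_of_card_le (hsub v hv.1 w hw.1 (by omega)) (by omega)

/-- Searching in several chains of finite sets. -/
theorem of_chains {J : Type*} (s : Finset J) {S : Finset V} {b : ℝ} (L : J → V → Finset E)
    (hL : ∀ a ∈ s, ∀ v ∈ S, ∀ w ∈ S, L a v ⊆ L a w ∨ L a w ⊆ L a v)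
    (hq : ∀ a ∈ s, ∀ e, Queryable test S fun v => e ∈ L a v)
    (H : ∀ S' ⊆ S, S'.Nonempty → (∀ a ∈ s, ∀ v ∈ S', ∀ w ∈ S', L a v = L a w) →
      Resolvable test G (b - 2 * s.card - 2 * (bits S - bits S')) S') :
    Resolvable test G b S := by
  classical
  induction s using Finset.induction_on generalizing S b with
  | empty =>
    rcases S.eq_empty_or_nonempty with rfl | hS
    · exact .empty _
    · exact (H S subset_rfl hS (by simp)).mono (by simp)
  | insert a s ha ih =>
    refine of_chain (L a) (hL a (s.mem_insert_self a)) (hq a (s.mem_insert_self a)) ?_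
    intro S' hS' _ hconst
    refine ih (fun c hc v hv w hw => hL c (Finset.mem_insert_of_mem hc) v (hS' hv) w (hS' hw))
      (fun c hc e => (hq c (Finset.mem_insert_of_mem hc) e).mono hS') ?_
    intro S'' hS'' hne hconst'
    refine (H S'' (hS''.trans hS') hne ?_).mono ?_
    · intro c hc v hv w hw
      rcases Finset.mem_insert.1 hc with rfl | hc
      · exact hconst v (hS'' hv) w (hS'' hw)
      · exact hconst' c hc v hv w hw
    · rw [Finset.card_insert_of_notMem ha]
      push_cast
      linarith

/-- Sorting the values `val v e`, `e ∈ D`. -/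
theorem of_sort (D : Finset E) {S : Finset V} {b : ℝ} (val : V → E → ℝ)
    (hq : ∀ e e', Queryable test S fun v => val v e ≤ val v e')
    (H : ∀ S' ⊆ S, S'.Nonempty → (∀ e ∈ D, ∀ e' ∈ D, ∀ v ∈ S', ∀ w ∈ S',
        val v e ≤ val v e' → val w e ≤ val w e') →
      Resolvable test G (b - 4 * D.card - 2 * (bits S - bits S')) S') :
    Resolvable test G b S := by
  classical
  induction D using Finset.induction_on generalizing S b with
  | empty =>
    rcases S.eq_empty_or_nonempty with rfl | hS
    · exact .empty _
    · exact (H S subset_rfl hS (by simp)).mono (by simp)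
  | insert p D hp ih =>
    refine ih hq fun S₁ hS₁ _ hD => ?_
    -- Insertion of `p`: lower and upper sets of the already ordered `D` form chains. Both are
    -- searched so that ties with `p` are detected; hence `4` per element.
    refine of_chains (Finset.univ : Finset Bool)
      (fun c v => D.filter fun e => if c then val v e ≤ val v p else val v p ≤ val v e) ?_ ?_ ?_
    · intro c _ v hv w hw
      by_contra! hcon
      obtain ⟨e, he, he'⟩ := Finset.not_subset.1 hcon.1
      obtain ⟨e₁, he₁, he₁'⟩ := Finset.not_subset.1 hcon.2
      simp only [Finset.mem_filter] at he he' he₁ he₁'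
      replace he' := fun h => he' ⟨he.1, h⟩
      replace he₁' := fun h => he₁' ⟨he₁.1, h⟩
      cases c
      · simp only [Bool.false_eq_true, if_false, imp_false, not_le] at *
        linarith [hD e₁ he₁.1 e he.1 v hv w hw (by linarith)]
      · simp only [if_true, imp_false, not_le] at *
        linarith [hD e he.1 e₁ he₁.1 v hv w hw (by linarith)]
    · intro c _ e
      by_cases he : e ∈ D
      · cases c
        · exact ((hq p e).mono hS₁).congr fun v _ => by simp [he]
        · exact ((hq e p).mono hS₁).congr fun v _ => by simp [he]
      · exact .inr (.inr (.inr fun v _ => by simp [he]))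
    · intro S₂ hS₂ hne hconst
      refine (H S₂ (hS₂.trans hS₁) hne ?_).mono ?_
      · intro e he e' he' v hv w hw hle
        rcases Finset.mem_insert.1 he with rfl | hD₀
        · rcases Finset.mem_insert.1 he' with rfl | hD'
          · exact le_rfl
          · have := Finset.ext_iff.1 (hconst false (Finset.mem_univ _) v hv w hw) e'
            simp only [Finset.mem_filter, Bool.false_eq_true, if_false] at this
            exact (this.1 ⟨hD', hle⟩).2
        · rcases Finset.mem_insert.1 he' with rfl | hD'
          · have := Finset.ext_iff.1 (hconst true (Finset.mem_univ _) v hv w hw) e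
            simp only [Finset.mem_filter, if_true] at this
            exact (this.1 ⟨hD₀, hle⟩).2
          · exact hD e hD₀ e' hD' v (hS₂ hv) w (hS₂ hw) hle
      · rw [Finset.card_insert_of_notMem hp]
        simp only [Finset.card_univ, Fintype.card_bool]
        push_cast
        linarith

end Resolvable

end Resolvable

/-! ### Sign patterns of linear forms -/

section SignPatterns

variable {T ι : Type*} [Fintype ι]

/-- Shattered forms are linearly independent: in a relation with a positive coefficient, an input
whose signs match those of the coefficients makes the sum positive. The negated relation excludes
negative coefficients. -/
theorem card_le_of_shatters_signPatterns (l : T → (ι → ℝ) →ₗ[ℝ] ℝ) (s : Finset T)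
    (hs : ∀ t ⊆ s, ∃ v, ∀ τ ∈ s, l τ v ≤ 0 ↔ τ ∈ t) : s.card ≤ Fintype.card ι := by
  classical
  have key : ∀ g : s → ℝ, ∑ i, g i • l i = 0 → ∀ i, g i ≤ 0 := by
    intro g hg i₀
    by_contra! hi₀
    obtain ⟨v, hv⟩ := hs ((Finset.univ.filter fun i : s => g i ≤ 0).image Subtype.val) (by
      intro τ hτ
      simp only [Finset.mem_image] at hτ
      obtain ⟨i, -, rfl⟩ := hτ
      exact i.2)
    have hsign : ∀ i : s, l i v ≤ 0 ↔ g i ≤ 0 := by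
      intro i
      rw [hv i i.2]
      simp
    have hpos : 0 < ∑ i, g i * l i v := by
      refine Finset.sum_pos' (fun i _ => ?_) ⟨i₀, Finset.mem_univ _, ?_⟩
      · rcases le_or_gt (g i) 0 with h | h
        · exact mul_nonneg_of_nonpos_of_nonpos h ((hsign i).2 h)
        · exact mul_nonneg h.le (not_le.1 (mt (hsign i).1 h.not_ge)).le
      · exact mul_pos hi₀ (not_le.1 (mt (hsign i₀).1 hi₀.not_ge))
    have := congrArg (fun φ : (ι → ℝ) →ₗ[ℝ] ℝ => φ v) hg
    simp only [LinearMap.sum_apply, LinearMap.smul_apply, smul_eq_mul, LinearMap.zero_apply] at this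
    exact hpos.ne' this
  have hli : LinearIndependent ℝ fun i : s => l i := by
    rw [Fintype.linearIndependent_iff]
    intro g hg i
    refine le_antisymm (key g hg i) ?_
    have := key (-g) (LinearMap.ext fun x => by
      have := congrArg (fun φ : (ι → ℝ) →ₗ[ℝ] ℝ => φ x) hg
      simp only [LinearMap.sum_apply, LinearMap.smul_apply, smul_eq_mul,
        LinearMap.zero_apply] at this
      simp only [LinearMap.sum_apply, LinearMap.smul_apply, smul_eq_mul, LinearMap.zero_apply,
        Pi.neg_apply, neg_mul, Finset.sum_neg_distrib, this, neg_zero]) i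
    simpa using this
  have := hli.fintype_card_le_finrank
  rwa [Fintype.card_coe, Subspace.dual_finrank_eq, Module.finrank_fintype_fun_eq_card] at this

theorem sum_choose_le_pow (m d : ℕ) : ∑ k ∈ Finset.range (d + 1), m.choose k ≤ (m + 1) ^ d := by
  rw [add_pow]
  refine Finset.sum_le_sum fun k hk => ?_
  rw [one_pow, mul_one]
  have h1 : 0 < d.choose k := Nat.choose_pos (Nat.lt_succ_iff.1 (Finset.mem_range.1 hk))
  exact (Nat.choose_le_pow m k).trans (Nat.le_mul_of_pos_right _ h1)

/-- Linear forms `l τ` on `ℝ^ι` have few sign patterns. -/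
theorem exists_signPattern_representatives [Fintype T] (l : T → (ι → ℝ) →ₗ[ℝ] ℝ) :
    ∃ Γ : Finset (ι → ℝ), Γ.card ≤ (Fintype.card T + 1) ^ Fintype.card ι ∧
      ∀ v, ∃ w ∈ Γ, ∀ τ, l τ v ≤ 0 ↔ l τ w ≤ 0 := by
  classical
  let pat : (ι → ℝ) → Finset T := fun v => Finset.univ.filter fun τ => l τ v ≤ 0
  let 𝒜 : Finset (Finset T) := Finset.univ.filter fun s => ∃ v, pat v = s
  have hdim : 𝒜.vcDim ≤ Fintype.card ι := by
    refine Finset.sup_le fun s hs => card_le_of_shatters_signPatterns l s fun t ht => ?_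
    obtain ⟨u, hu, rfl⟩ := Finset.mem_shatterer.1 hs ht
    obtain ⟨v, rfl⟩ := (Finset.mem_filter.1 hu).2
    exact ⟨v, fun τ hτ => by simp [pat, hτ]⟩
  have hcard : 𝒜.card ≤ (Fintype.card T + 1) ^ Fintype.card ι := by
    refine 𝒜.card_le_card_shatterer.trans (Finset.card_shatterer_le_sum_vcDim.trans
      (le_trans ?_ (sum_choose_le_pow _ _)))
    refine Finset.sum_le_sum_of_subset fun k hk => ?_
    rw [Finset.mem_range]
    have := Finset.mem_Iic.1 hk
    omega
  -- The default `0` is never taken, since every member of `𝒜` is a realized pattern.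
  refine ⟨𝒜.image fun s => if h : ∃ v, pat v = s then h.choose else 0,
    Finset.card_image_le.trans hcard, fun v => ?_⟩
  have h : ∃ w, pat w = pat v := ⟨v, rfl⟩
  refine ⟨h.choose, Finset.mem_image.2 ⟨pat v, Finset.mem_filter.2 ⟨Finset.mem_univ _, h⟩,
    dif_pos h⟩, fun τ => ?_⟩
  have := Finset.ext_iff.1 h.choose_spec τ
  simpa [pat] using this.symm

end SignPatterns

/-! ### Selection from sorted blocks -/

section Selection

variable {V T E : Type*}

/-- The elements below the least such `p` exceed three quarters of `A` and are disjoint from the set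
being counted. -/
theorem card_filter_many_below {β : Type*} [LinearOrder β] (A : Finset E) (ρ : E → β) :
    4 * (A.filter fun p => 3 * A.card < 4 * (A.filter fun i => ρ i < ρ p).card).card ≤ A.card := by
  classical
  set P := A.filter fun p => 3 * A.card < 4 * (A.filter fun i => ρ i < ρ p).card with hP
  rcases P.eq_empty_or_nonempty with h0 | hne
  · simp [h0]
  obtain ⟨p, hp, hmin⟩ := Finset.exists_min_image P ρ hne
  have hdisj : Disjoint P (A.filter fun i => ρ i < ρ p) :=
    Finset.disjoint_left.2 fun i hi hi' => (hmin i hi).not_gt (Finset.mem_filter.1 hi').2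
  have hle := Finset.card_le_card
    (Finset.union_subset (Finset.filter_subset _ A) (Finset.filter_subset _ A) :
      P ∪ (A.filter fun i => ρ i < ρ p) ⊆ A)
  rw [Finset.card_union_of_disjoint hdisj] at hle
  have := (Finset.mem_filter.1 hp).2
  omega

/-- Neither of the two sides of the pivot `p` holds more than three quarters of `A`. -/
def BalancedPivot {β : Type*} [LinearOrder β] (A : Finset E) (ρ : E → β) (p : E) : Prop :=
  4 * (A.filter fun i => ρ i < ρ p).card ≤ 3 * A.card ∧
    4 * (A.filter fun i => ρ p < ρ i).card ≤ 3 * A.card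

open Classical in
theorem card_le_two_mul_card_balancedPivot {β : Type*} [LinearOrder β] (A : Finset E) (ρ : E → β) :
    A.card ≤ 2 * (A.filter (BalancedPivot A ρ)).card := by
  have h1 := card_filter_many_below A ρ
  have h2 := card_filter_many_below A fun i => OrderDual.toDual (ρ i)
  simp only [OrderDual.toDual_lt_toDual] at h2
  have hsub : A ⊆ A.filter (BalancedPivot A ρ) ∪
      ((A.filter fun p => 3 * A.card < 4 * (A.filter fun i => ρ i < ρ p).card) ∪
        A.filter fun p => 3 * A.card < 4 * (A.filter fun i => ρ p < ρ i).card) := by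
    intro p hp
    simp only [Finset.mem_union, Finset.mem_filter, hp, true_and, BalancedPivot]
    by_contra! h
    omega
  have h3 := (Finset.card_le_card hsub).trans
    ((Finset.card_union_le _ _).trans (Nat.add_le_add_left (Finset.card_union_le _ _) _))
  omega

-- Double counting: for each `v` at least half of `A` is balanced, so some `p` is balanced for at
-- least half of `S`.
open Classical in
theorem exists_balancedPivot {β : Type*} [LinearOrder β] {A : Finset E} (hA : A.Nonempty)
    (S : Finset V) (ρ : V → E → β) :
    ∃ p ∈ A, 2 * (S.filter fun v => ¬ BalancedPivot A (ρ v) p).card ≤ S.card := by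
  by_contra! h
  have h1 : ∀ p ∈ A, 2 * (S.filter fun v => BalancedPivot A (ρ v) p).card < S.card := by
    intro p hp
    have := h p hp
    have := Finset.card_filter_add_card_filter_not (s := S) (fun v => BalancedPivot A (ρ v) p)
    omega
  have h2 := Finset.sum_lt_sum_of_nonempty hA h1
  have h3 := Finset.sum_le_sum fun v (_ : v ∈ S) => card_le_two_mul_card_balancedPivot A (ρ v)
  have h4 := Finset.sum_card_bipartiteAbove_eq_sum_card_bipartiteBelow (s := S) (t := A)
    (fun v p => BalancedPivot A (ρ v) p)
  simp only [Finset.bipartiteAbove, Finset.bipartiteBelow] at h4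
  rw [← Finset.mul_sum, Finset.sum_const, smul_eq_mul] at h2 h3
  rw [h4, mul_comm] at h3
  omega

/-- The positions which, over the inputs in `S`, may hold the entry of rank `t`. -/
def activePositions {m : ℕ} (ρ : V → Fin m → Fin m) (t : Fin m) (S : Finset V) : Finset (Fin m) :=
  Finset.univ.filter fun i => (∃ v ∈ S, t ≤ ρ v i) ∧ ∃ v ∈ S, ρ v i ≤ t

theorem activePositions_mono {m : ℕ} (ρ : V → Fin m → Fin m) (t : Fin m) {S S' : Finset V}
    (h : S' ⊆ S) : activePositions ρ t S' ⊆ activePositions ρ t S := by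
  intro i hi
  obtain ⟨-, ⟨v, hv, h1⟩, w, hw, h2⟩ := Finset.mem_filter.1 hi
  exact Finset.mem_filter.2 ⟨Finset.mem_univ _, ⟨v, h hv, h1⟩, w, h hw, h2⟩

theorem mem_activePositions {m : ℕ} (π : V → Equiv.Perm (Fin m)) (t : Fin m) {S : Finset V}
    {v : V} (hv : v ∈ S) : π v t ∈ activePositions (fun v => (π v).symm) t S :=
  Finset.mem_filter.2 ⟨Finset.mem_univ _, ⟨v, hv, by simp⟩, v, hv, by simp⟩

theorem Equiv.Perm.card_filter_symm_lt {m : ℕ} (σ : Equiv.Perm (Fin m)) (c : Fin m) :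
    (Finset.univ.filter fun i => σ.symm i < c).card = c := by
  rw [← Fin.card_Iio c, ← Finset.card_map σ.toEmbedding (s := Finset.Iio c)]
  congr 1
  ext i
  simp

/-- Since `(4 / 3) ^ 3 ≥ 2`, a shrinkage to three quarters lowers `3 log₂` by at least one; this is
the `6 r = 2 r * 3` in `of_select`. -/
theorem three_mul_logb_add_one_le {a a' : ℕ} (ha' : 0 < a') (h : 4 * a' ≤ 3 * a) :
    3 * Real.logb 2 a' + 1 ≤ 3 * Real.logb 2 a := by
  have h0 : (0 : ℝ) < a' := by exact_mod_cast ha'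
  have h1 : (4 : ℝ) / 3 * a' ≤ a := by
    have : (4 : ℝ) * a' ≤ 3 * a := by exact_mod_cast h
    linarith
  have h2 : (2 : ℝ) * a' ^ 3 ≤ a ^ 3 := by
    have := pow_le_pow_left₀ (by positivity) h1 3
    have : (0 : ℝ) < a' ^ 3 := by positivity
    nlinarith
  have h3 := Real.logb_le_logb_of_le (b := 2) (by norm_num) (by positivity) h2
  rw [Real.logb_mul (by norm_num) (by positivity), Real.logb_self_eq_one (by norm_num),
    Real.logb_pow, Real.logb_pow] at h3
  push_cast at h3
  linarith

variable {test : T → V → Prop} {G : Finset V → Prop}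

/-- Finding the position of the entry of rank `t` among `m` numbers which are divided into `r`
blocks of known order; `π v` is the permutation that sorts them. -/
theorem Resolvable.of_select {m : ℕ} (π : V → Equiv.Perm (Fin m)) (blk : Fin m → ℕ) {r : ℕ}
    (hr : ∀ i, blk i < r) (t : Fin m) {S : Finset V} {b : ℝ}
    (hq : ∀ i j, Queryable test S fun v => (π v).symm i < (π v).symm j)
    (hblk : ∀ i j, blk i = blk j → ∀ v ∈ S, ∀ w ∈ S,
      (π v).symm i < (π v).symm j → (π w).symm i < (π w).symm j)
    (H : ∀ S' ⊆ S, S'.Nonempty → (∀ v ∈ S', ∀ w ∈ S', π v t = π w t) →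
      Resolvable test G (b - (2 + 2 * r) * (bits S - bits S')) S') :
    Resolvable test G
      (b + 6 * r * Real.logb 2 (activePositions (fun v => (π v).symm) t S).card) S := by
  classical
  induction hN : S.card + (activePositions (fun v => (π v).symm) t S).card
    using Nat.strong_induction_on generalizing S b with
  | _ N ih =>
  subst hN
  rcases S.eq_empty_or_nonempty with rfl | ⟨v₀, hv₀⟩
  · exact .empty _
  set A := activePositions (fun v => (π v).symm) t S with hA
  have hAne : A.Nonempty := ⟨_, mem_activePositions π t hv₀⟩
  have hA1 : (1 : ℝ) ≤ A.card := by exact_mod_cast hAne.card_pos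
  have hlog : 0 ≤ Real.logb 2 A.card := Real.logb_nonneg (by norm_num) hA1
  have hr0 : (0 : ℝ) ≤ r := Nat.cast_nonneg r
  rcases Nat.lt_or_ge 1 A.card with hA2 | hA2
  swap
  · refine (H S subset_rfl ⟨v₀, hv₀⟩ fun v hv w hw => ?_).mono (by
      have : 0 ≤ 6 * r * Real.logb 2 A.card := by positivity
      simpa using this)
    exact Finset.card_le_one.1 hA2 _ (mem_activePositions π t hv) _ (mem_activePositions π t hw)
  obtain ⟨p, -, hp⟩ := exists_balancedPivot hAne S fun v => (π v).symm
  -- Inside a block of known order, the elements below the pivot form an initial segment, hence a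
  -- chain as the input varies.
  refine of_chains (Finset.range r)
    (fun a v => Finset.univ.filter fun i => blk i = a ∧ (π v).symm i < (π v).symm p) ?_ ?_ ?_
  · intro a _ v hv w hw
    by_contra! hcon
    obtain ⟨i, hi, hi'⟩ := Finset.not_subset.1 hcon.1
    obtain ⟨j, hj, hj'⟩ := Finset.not_subset.1 hcon.2
    simp only [Finset.mem_filter, Finset.mem_univ, true_and, not_and, not_lt] at hi hi' hj hj'
    have h1 := hblk i j (hi.1.trans hj.1.symm) v hv w hw (hi.2.trans_le (hj' hj.1))
    exact (h1.trans hj.2).not_ge (hi' hi.1)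
  · intro a _ i
    by_cases h : blk i = a
    · exact (hq i p).congr fun v _ => by simp [h]
    · exact .inr (.inr (.inr fun v _ => by simp [h]))
  intro S' hS' hne hconst
  have hlt : ∀ i, ∀ v ∈ S', ∀ w ∈ S', (π v).symm i < (π v).symm p → (π w).symm i < (π w).symm p := by
    intro i v hv w hw h
    have := Finset.ext_iff.1 (hconst (blk i) (Finset.mem_range.2 (hr i)) v hv w hw) i
    simpa [h] using this
  have hgt : ∀ i, ∀ v ∈ S', ∀ w ∈ S', (π v).symm p < (π v).symm i → (π w).symm p < (π w).symm i := by
    intro i v hv w hw h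
    rcases lt_trichotomy ((π w).symm i) ((π w).symm p) with h1 | h1 | h1
    · exact absurd (hlt i w hw v hv h1) h.not_gt
    · rw [(π w).symm.injective h1] at h
      exact absurd h (lt_irrefl _)
    · exact h1
  have hrank : ∀ v ∈ S', ∀ w ∈ S', (π v).symm p = (π w).symm p := by
    intro v hv w hw
    rw [Fin.ext_iff, ← (π v).card_filter_symm_lt, ← (π w).card_filter_symm_lt]
    congr 1
    ext i
    simpa using ⟨hlt i v hv w hw, hlt i w hw v hv⟩
  obtain ⟨u, hu⟩ := hne
  have hbits := bits_mono hS' ⟨u, hu⟩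
  rw [Finset.card_range]
  set A' := activePositions (fun v => (π v).symm) t S' with hA'
  have hA'A : A' ⊆ A := activePositions_mono _ t hS'
  have hA'pos : 0 < A'.card := Finset.card_pos.2 ⟨_, mem_activePositions π t hu⟩
  have hrec : S'.card + A'.card < S.card + A.card →
      Resolvable test G (b - (2 + 2 * r) * (bits S - bits S') + 6 * r * Real.logb 2 A'.card) S' := by
    intro hlt'
    refine ih _ hlt' (fun i j => (hq i j).mono hS')
      (fun i j hij v hv w hw => hblk i j hij v (hS' hv) w (hS' hw)) ?_ rfl
    intro S'' hS'' hne'' hconst''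
    refine (H S'' (hS''.trans hS') hne'' hconst'').mono (le_of_eq (by ring))
  have hScard := Finset.card_le_card hS'
  have hAcard := Finset.card_le_card hA'A
  by_cases hbal : BalancedPivot A (π u).symm p
  · have hside : (t ≠ (π u).symm p) → 4 * A'.card ≤ 3 * A.card := by
      intro ht
      rcases lt_or_gt_of_ne ht with ht | ht
      · refine le_trans (Nat.mul_le_mul_left 4 (Finset.card_le_card fun i hi => ?_)) hbal.1
        refine Finset.mem_filter.2 ⟨hA'A hi, ?_⟩
        obtain ⟨-, -, w, hw, hwi⟩ := Finset.mem_filter.1 hi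
        exact hlt i w hw u hu (hwi.trans_lt (by rwa [hrank w hw u hu]))
      · refine le_trans (Nat.mul_le_mul_left 4 (Finset.card_le_card fun i hi => ?_)) hbal.2
        refine Finset.mem_filter.2 ⟨hA'A hi, ?_⟩
        obtain ⟨-, ⟨w, hw, hwi⟩, -⟩ := Finset.mem_filter.1 hi
        exact hgt i w hw u hu (lt_of_lt_of_le (by rwa [hrank w hw u hu]) hwi)
    by_cases ht : t = (π u).symm p
    -- The pivot is the sought entry. At least two positions were active, so the potential `6 r log₂
    -- |A|` covers the `2 r` just spent.
    · refine (H S' hS' ⟨u, hu⟩ fun v hv w hw => ?_).mono ?_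
      · rw [(Equiv.eq_symm_apply (π v)).1 (ht.trans (hrank u hu v hv)),
          (Equiv.eq_symm_apply (π w)).1 (ht.trans (hrank u hu w hw))]
      · have h2 : 1 ≤ Real.logb 2 A.card := by
          rw [← Real.logb_self_eq_one (b := 2) (by norm_num)]
          exact Real.logb_le_logb_of_le (by norm_num) (by norm_num) (by exact_mod_cast hA2)
        nlinarith [mul_nonneg hr0 (sub_nonneg.2 h2), mul_nonneg hr0 (sub_nonneg.2 hbits)]
    · have h4 := hside ht
      have h5 := three_mul_logb_add_one_le hA'pos h4
      refine (hrec (by omega)).mono ?_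
      nlinarith [mul_nonneg hr0 (sub_nonneg.2 h5), mul_nonneg hr0 (sub_nonneg.2 hbits)]
  -- Balance depends only on what is now known, so all of `S'` lies in the minority half: a bit is
  -- gained and pays `2 r`.
  · have hbad : S' ⊆ S.filter fun v => ¬ BalancedPivot A (π v).symm p := by
      intro w hw
      refine Finset.mem_filter.2 ⟨hS' hw, fun hw' => hbal ?_⟩
      have e1 : ∀ i, (π u).symm i < (π u).symm p ↔ (π w).symm i < (π w).symm p :=
        fun i => ⟨hlt i u hu w hw, hlt i w hw u hu⟩
      have e2 : ∀ i, (π u).symm p < (π u).symm i ↔ (π w).symm p < (π w).symm i :=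
        fun i => ⟨hgt i u hu w hw, hgt i w hw u hu⟩
      simpa only [BalancedPivot, e1, e2] using hw'
    have h6 : 2 * S'.card ≤ S.card := (Nat.mul_le_mul_left 2 (Finset.card_le_card hbad)).trans hp
    have h7 := bits_add_one_le h6 ⟨u, hu⟩
    have h8 : Real.logb 2 A'.card ≤ Real.logb 2 A.card :=
      Real.logb_le_logb_of_le (by norm_num) (by exact_mod_cast hA'pos) (by exact_mod_cast hAcard)
    have hSpos : 0 < S'.card := Finset.card_pos.2 ⟨u, hu⟩
    refine (hrec (by omega)).mono ?_
    nlinarith [mul_nonneg hr0 (sub_nonneg.2 h7), mul_nonneg hr0 (sub_nonneg.2 h8)]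

end Selection

/-! ### From strategies to linear decision trees -/

section Tuple

variable {m : ℕ} {α : Type*} [LinearOrder α]

/-- `Tuple.sort` breaks ties by index, so ranks are compared by one non-strict test or the negation
of one. -/
theorem Tuple.sort_symm_lt_iff (f : Fin m → α) (i j : Fin m) :
    (Tuple.sort f).symm i < (Tuple.sort f).symm j ↔ f i < f j ∨ f i = f j ∧ i < j := by
  obtain ⟨hmono, htie⟩ := (Tuple.eq_sort_iff (f := f)).1 rfl
  have key : ∀ i j, (Tuple.sort f).symm i < (Tuple.sort f).symm j →
      f i < f j ∨ f i = f j ∧ i < j := by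
    intro i j h
    have h1 := hmono h.le
    have h2 := htie _ _ h
    simp only [Function.comp_apply, Equiv.apply_symm_apply] at h1 h2
    exact h1.lt_or_eq.imp_right fun h => ⟨h, h2 h⟩
  refine ⟨key i j, fun h => ?_⟩
  rcases lt_trichotomy ((Tuple.sort f).symm i) ((Tuple.sort f).symm j) with h1 | h1 | h1
  · exact h1
  · rw [(Tuple.sort f).symm.injective h1] at h
    simp at h
  · rcases h with h | ⟨h, hij⟩ <;> rcases key j i h1 with h' | ⟨h', hji⟩
    · exact absurd h h'.not_gt
    · exact absurd h'.symm h.ne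
    · exact absurd h.symm h'.ne
    · exact absurd hij hji.not_gt

theorem Tuple.sort_congr {f g : Fin m → α} (h : ∀ i j, f i ≤ f j ↔ g i ≤ g j) :
    Tuple.sort f = Tuple.sort g := by
  obtain ⟨hmono, htie⟩ := (Tuple.eq_sort_iff (f := f)).1 rfl
  exact Tuple.eq_sort_iff.2 ⟨fun i j hij => (h _ _).1 (hmono hij), fun i j hij hg =>
    htie i j hij (le_antisymm ((h _ _).2 hg.le) ((h _ _).2 hg.ge))⟩

end Tuple

namespace Resolvable

/-- A strategy whose final knowledge determines affine forms for the output yields a linear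
decision tree. -/
theorem exists_linearDecisionTree {T ι κ : Type} {test : T → (ι → ℝ) → Prop}
    {G : Finset (ι → ℝ) → Prop} {F : (ι → ℝ) → κ → ℝ} (l : T → (ι → ℝ) →ᵃ[ℝ] ℝ)
    (hl : ∀ τ v, test τ v ↔ l τ v ≤ 0)
    (hG : ∀ S : Finset (ι → ℝ), S.Nonempty → G S → ∃ out : κ → (ι → ℝ) →ᵃ[ℝ] ℝ,
      ∀ v, (∃ w ∈ S, ∀ τ, test τ v ↔ test τ w) → ∀ k, out k v = F v k)
    {b : ℝ} {S : Finset (ι → ℝ)} (h : Resolvable test G b S) (hS : S.Nonempty) :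
    ∃ t : LinearDecisionTree ι κ, (t.depth : ℝ) ≤ b ∧
      ∀ v, (∃ w ∈ S, ∀ τ, test τ v ↔ test τ w) → t.run v = F v := by
  classical
  induction h with
  | empty => exact absurd hS Finset.not_nonempty_empty
  | done hb hGS =>
    obtain ⟨out, hout⟩ := hG _ hS hGS
    exact ⟨.leaf out, by simpa [LinearDecisionTree.depth] using hb,
      fun v hv => funext fun k => hout v hv k⟩
  | @query b S τ _ _ ih1 ih2 =>
    have hyes : ∀ v, test τ v → (∃ w ∈ S, ∀ τ, test τ v ↔ test τ w) →
        ∃ w ∈ S.filter (test τ), ∀ τ, test τ v ↔ test τ w := by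
      rintro v hv ⟨w, hw, hvw⟩
      exact ⟨w, Finset.mem_filter.2 ⟨hw, (hvw τ).1 hv⟩, hvw⟩
    have hno : ∀ v, ¬ test τ v → (∃ w ∈ S, ∀ τ, test τ v ↔ test τ w) →
        ∃ w ∈ S.filter fun w => ¬ test τ w, ∀ τ, test τ v ↔ test τ w := by
      rintro v hv ⟨w, hw, hvw⟩
      exact ⟨w, Finset.mem_filter.2 ⟨hw, mt (hvw τ).2 hv⟩, hvw⟩
    -- A test with only one possible outcome is omitted from the tree.
    by_cases h1 : (S.filter (test τ)).Nonempty
    · by_cases h2 : (S.filter fun v => ¬ test τ v).Nonempty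
      · obtain ⟨t₁, hd₁, ht₁⟩ := ih1 (by convert h1)
        obtain ⟨t₂, hd₂, ht₂⟩ := ih2 (by convert h2)
        refine ⟨.node (l τ) t₁ t₂, ?_, fun v hv => ?_⟩
        · rw [LinearDecisionTree.depth]
          push_cast
          have := max_le hd₁ hd₂
          linarith
        · rw [LinearDecisionTree.run]
          split_ifs with hτ
          · exact ht₁ v (by convert hyes v ((hl τ v).2 hτ) hv)
          · exact ht₂ v (by convert hno v (mt (hl τ v).1 hτ) hv)
      · obtain ⟨t, hd, ht⟩ := ih1 (by convert h1)
        refine ⟨t, by linarith, fun v hv => ht v ?_⟩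
        have hτ : test τ v := by
          by_contra hτ
          obtain ⟨w, hw, -⟩ := hno v hτ hv
          exact h2 ⟨w, hw⟩
        convert hyes v hτ hv
    · have h2 : (S.filter fun v => ¬ test τ v).Nonempty := by
        obtain ⟨w, hw⟩ := hS
        exact ⟨w, Finset.mem_filter.2 ⟨hw, fun hτ => h1 ⟨w, Finset.mem_filter.2 ⟨hw, hτ⟩⟩⟩⟩
      obtain ⟨t, hd, ht⟩ := ih2 (by convert h2)
      refine ⟨t, by linarith, fun v hv => ht v ?_⟩
      have hτ : ¬ test τ v := by
        intro hτ
        obtain ⟨w, hw, -⟩ := hyes v hτ hv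
        exact h1 ⟨w, hw⟩
      convert hno v hτ hv

/-- The selections run one after another on the shrinking set of consistent inputs, so their
information costs telescope to a single term. -/
theorem of_selects {V T J : Type*} {test : T → V → Prop} {G : Finset V → Prop} {m : J → ℕ}
    (π : ∀ j, V → Equiv.Perm (Fin (m j))) (blk : ∀ j, Fin (m j) → ℕ) {r N : ℕ}
    (hr : ∀ j i, blk j i < r) (hm : ∀ j, m j ≤ N) (t : ∀ j, Fin (m j)) {S : Finset V} {b : ℝ}
    (hq : ∀ j i i', Queryable test S fun v => (π j v).symm i < (π j v).symm i')
    (hblk : ∀ j i i', blk j i = blk j i' → ∀ v ∈ S, ∀ w ∈ S,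
      (π j v).symm i < (π j v).symm i' → (π j w).symm i < (π j w).symm i')
    (s : Finset J)
    (H : ∀ S' ⊆ S, S'.Nonempty → (∀ j ∈ s, ∀ v ∈ S', ∀ w ∈ S', π j v (t j) = π j w (t j)) →
      Resolvable test G
        (b - s.card * (6 * r * Real.logb 2 N) - (2 + 2 * r) * (bits S - bits S')) S') :
    Resolvable test G b S := by
  classical
  induction s using Finset.induction_on generalizing S b with
  | empty =>
    rcases S.eq_empty_or_nonempty with rfl | hS
    · exact .empty _
    · exact (H S subset_rfl hS (by simp)).mono (by simp)
  | insert j s hj ih =>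
    rcases S.eq_empty_or_nonempty with rfl | ⟨v₀, hv₀⟩
    · exact .empty _
    refine (of_select (b := b - 6 * r * Real.logb 2 N) (π j) (blk j) (hr j) (t j) (hq j)
      (hblk j) ?_).mono ?_
    · intro S' hS' _ hconst
      refine ih (fun j i i' => (hq j i i').mono hS')
        (fun j i i' h v hv w hw => hblk j i i' h v (hS' hv) w (hS' hw)) ?_
      intro S'' hS'' hne hconst'
      refine (H S'' (hS''.trans hS') hne ?_).mono ?_
      · intro c hc v hv w hw
        rcases Finset.mem_insert.1 hc with rfl | hc
        · exact hconst v (hS'' hv) w (hS'' hw)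
        · exact hconst' c hc v hv w hw
      · rw [Finset.card_insert_of_notMem hj]
        push_cast
        linarith
    · have hpos := Finset.card_pos.2 ⟨_, mem_activePositions (π j) (t j) hv₀⟩
      have hle := (Finset.card_le_univ
        (activePositions (fun v => (π j v).symm) (t j) S)).trans
        ((Fintype.card_fin _).le.trans (hm j))
      have hlog := Real.logb_le_logb_of_le (b := 2) (by norm_num)
        (by exact_mod_cast hpos : (0 : ℝ) <
          (activePositions (fun v => (π j v).symm) (t j) S).card) (Nat.cast_le.2 hle)
      have := mul_le_mul_of_nonneg_left hlog (by positivity : (0 : ℝ) ≤ 6 * r)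
      linarith

end Resolvable

/-! ### The median convolution -/

namespace MedianConv

variable {n : ℕ}

/-- The numbers whose median is entry `k` of the convolution. -/
def entries (v : Fin n ⊕ Fin n → ℝ) (k : Fin n) (i : Fin ((k : ℕ) + 1)) : ℝ :=
  v (.inl ⟨i, by omega⟩) - v (.inr ⟨(k : ℕ) - i, by omega⟩)

/-- The ranks of the lower and of the upper median of `k + 1` numbers. -/
def middle (j : Fin n × Bool) : Fin ((j.1 : ℕ) + 1) :=
  if j.2 then ⟨(j.1 + 1) / 2, by omega⟩ else ⟨j.1 / 2, by omega⟩

/-- The comparison of two differences of input coordinates. -/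
def diffTest {ι : Type} (τ : (ι × ι) × ι × ι) (v : ι → ℝ) : Prop :=
  v τ.1.1 - v τ.1.2 ≤ v τ.2.1 - v τ.2.2

/-- The linear form whose sign decides `diffTest τ`. -/
def diffForm {ι : Type} (τ : (ι × ι) × ι × ι) : (ι → ℝ) →ₗ[ℝ] ℝ :=
  .proj τ.1.1 - .proj τ.1.2 - (.proj τ.2.1 - .proj τ.2.2)

theorem diffTest_iff {ι : Type} (τ : (ι × ι) × ι × ι) (v : ι → ℝ) :
    diffTest τ v ↔ diffForm τ v ≤ 0 := by
  simp [diffTest, diffForm]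

/-- The pairs of coordinates of the same vector whose indices differ by less than `d`. -/
def closePairs (n d : ℕ) : Finset ((Fin n ⊕ Fin n) × (Fin n ⊕ Fin n)) :=
  let P : Finset (Fin n × Fin n) :=
    Finset.univ.filter fun p => (p.1 : ℕ) < p.2 + d ∧ (p.2 : ℕ) < p.1 + d
  P.image (Prod.map .inl .inl) ∪ P.image (Prod.map .inr .inr)

theorem card_closePairs_le (n d : ℕ) : (closePairs n d).card ≤ 4 * (n * d) := by
  have hP : (Finset.univ.filter fun p : Fin n × Fin n =>
      (p.1 : ℕ) < p.2 + d ∧ (p.2 : ℕ) < p.1 + d).card ≤ n * (2 * d) := by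
    have : ((Finset.univ : Finset (Fin n)) ×ˢ Finset.range (2 * d)).card = n * (2 * d) := by simp
    rw [← this]
    -- The second index is encoded by its offset from the first, shifted by `d` to be a natural
    -- number below `2 * d`.
    refine Finset.card_le_card_of_injOn (fun p => (p.1, (p.2 : ℕ) + d - p.1)) ?_ ?_
    · intro p hp
      simp only [Finset.coe_filter, Finset.mem_univ, true_and, Set.mem_ofPred_eq] at hp
      simp only [Finset.coe_product, Finset.coe_univ, Finset.coe_range, Set.mem_prod,
        Set.mem_univ, Set.mem_Iio, true_and]
      omega
    · rintro ⟨i, j⟩ hp ⟨i', j'⟩ hp' h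
      simp only [Finset.coe_filter, Finset.mem_univ, true_and, Set.mem_ofPred_eq] at hp hp'
      simp only [Prod.mk.injEq] at h ⊢
      obtain ⟨rfl, h⟩ := h
      exact ⟨rfl, Fin.ext (by omega)⟩
  refine (Finset.card_union_le _ _).trans
    ((Nat.add_le_add Finset.card_image_le Finset.card_image_le).trans ?_)
  linarith

theorem queryable_sort_entries (S : Finset (Fin n ⊕ Fin n → ℝ)) (k : Fin n)
    (i j : Fin ((k : ℕ) + 1)) :
    Queryable diffTest S fun v =>
      (Tuple.sort (entries v k)).symm i < (Tuple.sort (entries v k)).symm j := by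
  simp only [Tuple.sort_symm_lt_iff]
  rcases lt_or_ge i j with h | h
  · refine .inl ⟨((.inl ⟨i, by omega⟩, .inr ⟨(k : ℕ) - i, by omega⟩),
      (.inl ⟨j, by omega⟩, .inr ⟨(k : ℕ) - j, by omega⟩)), fun v _ => ?_⟩
    change entries v k i ≤ entries v k j ↔ _
    simp only [h, and_true, le_iff_lt_or_eq]
  · refine .inr (.inl ⟨((.inl ⟨j, by omega⟩, .inr ⟨(k : ℕ) - j, by omega⟩),
      (.inl ⟨i, by omega⟩, .inr ⟨(k : ℕ) - i, by omega⟩)), fun v _ => ?_⟩)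
    change entries v k j ≤ entries v k i ↔ _
    simp only [h.not_gt, and_false, or_false, not_lt]

/-- The order of the close differences determines the order of the entries in a block. -/
theorem entries_le_of_closePairs {d : ℕ} {v w : Fin n ⊕ Fin n → ℝ}
    (h : ∀ e ∈ closePairs n d, ∀ e' ∈ closePairs n d,
      v e.1 - v e.2 ≤ v e'.1 - v e'.2 → w e.1 - w e.2 ≤ w e'.1 - w e'.2)
    (hd : 0 < d) (k : Fin n) {i j : Fin ((k : ℕ) + 1)} (hij : (i : ℕ) / d = (j : ℕ) / d)
    (hle : entries v k i ≤ entries v k j) : entries w k i ≤ entries w k j := by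
  have hi := Nat.div_add_mod (i : ℕ) d
  have hj := Nat.div_add_mod (j : ℕ) d
  have hi' := Nat.mod_lt (i : ℕ) hd
  have hj' := Nat.mod_lt (j : ℕ) hd
  rw [hij] at hi
  -- Fredman's rearrangement: both differences are close because `i` and `j` lie in the same block
  -- of length `d`.
  have := h (.inl ⟨i, by omega⟩, .inl ⟨j, by omega⟩) ?_
    (.inr ⟨(k : ℕ) - i, by omega⟩, .inr ⟨(k : ℕ) - j, by omega⟩) ?_ ?_
  · simp only [entries] at this ⊢
    linarith
  · refine Finset.mem_union_left _ (Finset.mem_image.2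
      ⟨(⟨i, by omega⟩, ⟨j, by omega⟩), Finset.mem_filter.2 ⟨Finset.mem_univ _, ?_⟩, rfl⟩)
    dsimp only
    omega
  · refine Finset.mem_union_right _ (Finset.mem_image.2
      ⟨(⟨(k : ℕ) - i, by omega⟩, ⟨(k : ℕ) - j, by omega⟩),
        Finset.mem_filter.2 ⟨Finset.mem_univ _, ?_⟩, rfl⟩)
    dsimp only
    omega
  · simp only [entries] at hle ⊢
    linarith

/-- The positions of all the lower and upper medians are known. -/
def MediansKnown (S : Finset (Fin n ⊕ Fin n → ℝ)) : Prop :=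
  ∀ j : Fin n × Bool, ∀ v ∈ S, ∀ w ∈ S,
    Tuple.sort (entries v j.1) (middle j) = Tuple.sort (entries w j.1) (middle j)

theorem resolvable_mediansKnown {d : ℕ} (hd : 0 < d) (Γ : Finset (Fin n ⊕ Fin n → ℝ)) :
    Resolvable diffTest MediansKnown (4 * (closePairs n d).card +
      2 * n * (6 * ((n / d + 1 : ℕ) : ℝ) * Real.logb 2 n) +
      (2 + 2 * ((n / d + 1 : ℕ) : ℝ)) * bits Γ) Γ := by
  refine .of_sort (closePairs n d) (fun v e => v e.1 - v e.2)
    (fun e e' => .inl ⟨(e, e'), fun v _ => Iff.rfl⟩) fun S hS hne hsorted => ?_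
  refine .of_selects (m := fun j : Fin n × Bool => (j.1 : ℕ) + 1)
    (fun j v => Tuple.sort (entries v j.1)) (fun _ i => (i : ℕ) / d) (r := n / d + 1) (N := n)
    (fun j i => Nat.lt_succ_of_le (Nat.div_le_div_right (by omega))) (fun j => j.1.2) middle
    (fun j => queryable_sort_entries S j.1) ?_ Finset.univ ?_
  · intro j i i' hii' v hv w hw
    have h1 := fun {a c} => entries_le_of_closePairs (i := a) (j := c)
      (fun e he e' he' => hsorted e he e' he' v hv w hw) hd j.1
    have h2 := fun {a c} => entries_le_of_closePairs (i := a) (j := c)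
      (fun e he e' he' => hsorted e he e' he' w hw v hv) hd j.1
    simp only [Tuple.sort_symm_lt_iff]
    rintro (h | ⟨h, hlt⟩)
    · exact .inl (lt_of_not_ge fun h' => h.not_ge (h2 hii'.symm h'))
    · exact .inr ⟨le_antisymm (h1 hii' h.le) (h1 hii'.symm h.ge), hlt⟩
  · intro S' hS' hne' hconst
    refine .done ?_ fun j => hconst j (Finset.mem_univ j)
    have h1 := bits_mono hS hne
    have h2 : 0 ≤ bits S' :=
      Real.logb_nonneg (by norm_num) (by exact_mod_cast hne'.card_pos)
    have hcard : ((Finset.univ : Finset (Fin n × Bool)).card : ℝ) = 2 * n := by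
      simp [mul_comm]
    rw [hcard]
    have h3 : (0 : ℝ) ≤ ((n / d + 1 : ℕ) : ℝ) := Nat.cast_nonneg _
    -- Sorting charges only `2` per bit, within the rate `2 + 2 r` allotted, so the remaining budget
    -- is nonnegative.
    nlinarith [mul_nonneg h3 (sub_nonneg.2 h1), mul_nonneg h3 h2]

/-- The linear form giving the number at position `i` among those for entry `k`. -/
def entryForm (k : Fin n) (i : Fin ((k : ℕ) + 1)) : (Fin n ⊕ Fin n → ℝ) →ₗ[ℝ] ℝ :=
  .proj (.inl ⟨i, by omega⟩) - .proj (.inr ⟨(k : ℕ) - i, by omega⟩)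

theorem exists_forms_of_mediansKnown (θ : ℝ) (S : Finset (Fin n ⊕ Fin n → ℝ)) (hS : S.Nonempty)
    (h : MediansKnown S) : ∃ out : Fin n → (Fin n ⊕ Fin n → ℝ) →ᵃ[ℝ] ℝ,
      ∀ v, (∃ w ∈ S, ∀ τ, diffTest τ v ↔ diffTest τ w) →
        ∀ k, out k v = medianConv θ (fun i => v (Sum.inl i)) (fun i => v (Sum.inr i)) k := by
  obtain ⟨u, hu⟩ := hS
  refine ⟨fun k => ((1 - θ) • entryForm k (Tuple.sort (entries u k) (middle (k, false))) +
    θ • entryForm k (Tuple.sort (entries u k) (middle (k, true)))).toAffineMap, ?_⟩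
  rintro v ⟨w, hw, hvw⟩ k
  have hsort : Tuple.sort (entries v k) = Tuple.sort (entries w k) :=
    Tuple.sort_congr fun i j => hvw ((.inl ⟨i, by omega⟩, .inr ⟨(k : ℕ) - i, by omega⟩),
      (.inl ⟨j, by omega⟩, .inr ⟨(k : ℕ) - j, by omega⟩))
  have hmid : ∀ c, Tuple.sort (entries u k) (middle (k, c)) =
      Tuple.sort (entries v k) (middle (k, c)) := fun c => by
    rw [hsort]
    exact h (k, c) u hu w hw
  beta_reduce
  rw [hmid, hmid]
  rfl

theorem exists_linearDecisionTree {d : ℕ} (hn : 2 ≤ n) (hd : 0 < d) (θ : ℝ) :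
    ∃ t : LinearDecisionTree (Fin n ⊕ Fin n) (Fin n),
      t.Computes (fun v => medianConv θ (fun i => v (Sum.inl i)) (fun i => v (Sum.inr i))) ∧
      (t.depth : ℝ) ≤ 16 * (n * d) + 12 * (n * (((n / d + 1 : ℕ) : ℝ) * Real.logb 2 n)) +
        (2 + 2 * ((n / d + 1 : ℕ) : ℝ)) * (18 * (n * Real.logb 2 n)) := by
  obtain ⟨Γ, hcard, hΓ⟩ := exists_signPattern_representatives (diffForm (ι := Fin n ⊕ Fin n))
  simp only [← diffTest_iff] at hΓ
  have hne : Γ.Nonempty := let ⟨w, hw, _⟩ := hΓ 0; ⟨w, hw⟩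
  obtain ⟨t, hdepth, ht⟩ := (resolvable_mediansKnown hd Γ).exists_linearDecisionTree
    (fun τ => (diffForm τ).toAffineMap) diffTest_iff
    (exists_forms_of_mediansKnown θ) hne
  refine ⟨t, fun v => ht v (hΓ v), hdepth.trans ?_⟩
  have hbits : bits Γ ≤ 18 * (n * Real.logb 2 n) := by
    -- There are `16 n ^ 4` tests in dimension `2 n`, and `16 n ^ 4 + 1 ≤ n ^ 9` because `n ≥ 2`.
    have h1 : Γ.card ≤ n ^ (9 * (n + n)) := by
      refine hcard.trans ?_
      simp only [Fintype.card_prod, Fintype.card_sum, Fintype.card_fin]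
      rw [pow_mul]
      refine Nat.pow_le_pow_left ?_ _
      have h16 : 16 ≤ n ^ 4 := Nat.pow_le_pow_left hn 4
      have h8 : 16 * n ^ 4 ≤ n ^ 8 := by
        calc 16 * n ^ 4 ≤ n ^ 4 * n ^ 4 := Nat.mul_le_mul_right _ h16
          _ = n ^ 8 := by ring
      have h9 : 2 * n ^ 8 ≤ n ^ 9 := by
        calc 2 * n ^ 8 ≤ n * n ^ 8 := Nat.mul_le_mul_right _ hn
          _ = n ^ 9 := by ring
      have : (n + n) * (n + n) * ((n + n) * (n + n)) = 16 * n ^ 4 := by ring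
      omega
    have h2 : (Γ.card : ℝ) ≤ (n : ℝ) ^ (9 * (n + n)) := by exact_mod_cast h1
    have h3 := Real.logb_le_logb_of_le (b := 2) (by norm_num)
      (by exact_mod_cast hne.card_pos) h2
    rw [Real.logb_pow] at h3
    push_cast at h3
    unfold bits
    linarith
  have hpairs : ((closePairs n d).card : ℝ) ≤ 4 * (n * d) := by
    exact_mod_cast card_closePairs_le n d
  have hr : (0 : ℝ) ≤ ((n / d + 1 : ℕ) : ℝ) := Nat.cast_nonneg _
  have := mul_le_mul_of_nonneg_left hbits (by positivity :
    (0 : ℝ) ≤ 2 + 2 * ((n / d + 1 : ℕ) : ℝ))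
  linarith

theorem computes_of_length_one (θ : ℝ) :
    (LinearDecisionTree.leaf fun k : Fin 1 => (entryForm k 0).toAffineMap).Computes
      (fun v => medianConv θ (fun i => v (Sum.inl i)) (fun i => v (Sum.inr i))) := by
  intro v
  funext k
  obtain rfl := Subsingleton.elim k 0
  have h : ∀ f : Fin 1 → ℝ, median (k := 0) θ f = f 0 := by
    intro f
    have : ∀ j, orderStat f j = f 0 := fun j => congrArg f (Subsingleton.elim _ _)
    simp only [median, this]
    ring
  exact (h (entries v 0)).symm

end MedianConv

theorem mainTheorem4 :
    ∃ C : ℝ, ∀ n : ℕ, 1 ≤ n → ∀ θ ∈ Set.Icc (0 : ℝ) 1,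
      ∃ t : LinearDecisionTree (Fin n ⊕ Fin n) (Fin n),
        t.Computes (fun v => medianConv θ (fun i => v (Sum.inl i)) (fun i => v (Sum.inr i))) ∧
        (t.depth : ℝ) ≤ C * (n * √(n * Real.logb 2 n)) := by
  -- With `d = ⌈s⌉₊`, `d ≤ 2 s`, `r l ≤ 2 s` and `l ≤ s`, the terms contribute `32 + 24 + (36 + 72)
  -- = 164` times `n s`.
  refine ⟨164, fun n hn θ _ => ?_⟩
  rcases hn.eq_or_lt with rfl | hn
  -- For `n = 1` the logarithm makes the bound `0`, so a bare leaf is required.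
  · exact ⟨_, MedianConv.computes_of_length_one θ, by simp [LinearDecisionTree.depth]⟩
  have hn2 : (2 : ℝ) ≤ n := by exact_mod_cast hn
  set l := Real.logb 2 n with hl
  set s := √(n * l) with hs
  have hl1 : 1 ≤ l := by
    rw [← Real.logb_self_eq_one (b := 2) (by norm_num)]
    exact Real.logb_le_logb_of_le (by norm_num) (by norm_num) hn2
  have hln : l ≤ n := by
    rw [hl, Real.logb_le_iff_le_rpow (by norm_num) (by linarith), Real.rpow_natCast]
    exact_mod_cast Nat.lt_two_pow_self.le
  have hss : s * s = n * l := Real.mul_self_sqrt (by positivity)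
  have hs1 : 1 ≤ s := Real.one_le_sqrt.2 (by nlinarith)
  have hls : l ≤ s := Real.le_sqrt_of_sq_le (by nlinarith)
  have hsn : s ≤ n := Real.sqrt_le_iff.2 ⟨by positivity, by nlinarith⟩
  have hsd : s ≤ ⌈s⌉₊ := Nat.le_ceil s
  have hds : (⌈s⌉₊ : ℝ) ≤ 2 * s := by
    have := Nat.ceil_lt_add_one (by linarith : 0 ≤ s)
    linarith
  have hd : 0 < ⌈s⌉₊ := Nat.ceil_pos.2 (by linarith)
  obtain ⟨t, ht, hdepth⟩ := MedianConv.exists_linearDecisionTree hn hd θ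
  refine ⟨t, ht, hdepth.trans ?_⟩
  rw [← hl]
  set r : ℝ := ((n / ⌈s⌉₊ + 1 : ℕ) : ℝ) with hr
  have hrs : r * s ≤ 2 * n := by
    have h1 : ((n / ⌈s⌉₊ : ℕ) : ℝ) * ⌈s⌉₊ ≤ n := by exact_mod_cast Nat.div_mul_le_self n _
    have h2 : ((n / ⌈s⌉₊ : ℕ) : ℝ) * s ≤ ((n / ⌈s⌉₊ : ℕ) : ℝ) * ⌈s⌉₊ :=
      mul_le_mul_of_nonneg_left hsd (Nat.cast_nonneg _)
    rw [hr]
    push_cast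
    linarith
  have hrl : r * l ≤ 2 * s := by
    have h1 : r * s * l ≤ 2 * n * l := mul_le_mul_of_nonneg_right hrs (by linarith)
    refine le_of_mul_le_mul_right (a := s) ?_ (by linarith)
    linarith
  have h1 := mul_le_mul_of_nonneg_left hds (by linarith : (0 : ℝ) ≤ n)
  have h2 := mul_le_mul_of_nonneg_left hrl (by linarith : (0 : ℝ) ≤ n)
  have h3 := mul_le_mul_of_nonneg_left hls (by linarith : (0 : ℝ) ≤ n)
  linarith
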